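/- Let $R$ be a $\mathbb Z$-graded ring that is graded commutative, i.e. $rs=(-1)^{|r||s|}sr$ for homogeneous $r,s\in R$, and noetherian. Let $\mathsf T$ be an essentially small triangulated category with suspension $\Sigma$, on which $R$ acts: there is given a homomorphism of graded rings from $R$ to the graded centre $Z^*(\mathsf T)=\bigoplus_{n\in\mathbb Z}\{\eta\colon \mathrm{Id}_{\mathsf T}\to\Sigma^n\mid \eta\Sigma=(-1)^n\Sigma\eta\}$. Let $\operatorname{Spec}R$ be the set of homogeneous prime ideals of $R$ and, for $\mathfrak p\in\operatorname{Spec}R$, let $\mathcal V(\mathfrak p)=\{\mathfrak q\in\operatorname{Spec}R\mid \mathfrak p\subseteq\mathfrak q\}$. Let $\operatorname{\mathsf{Coh}}\mathsf T$ be the category of cohomological functors $\mathsf T^{\mathrm{op}}\to\mathsf{Ab}$, i.e. functors taking exact triangles to exact sequences. Put $H_X=\operatorname{Hom}_{\mathsf T}(-,X)$ for $X\in\mathsf T$. For $F\in\operatorname{\mathsf{Coh}}\mathsf T$ and $X\in\mathsf T$ let $F^*(X)=\bigoplus_{n\in\mathbb Z}F(\Sigma^{-n}X)$, a graded $R$-module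 via the action of $R$ on $\mathsf T$, and write $\operatorname{End}^*_{\mathsf T}(X)=H_X^*(X)$. For $\mathfrak p\in\operatorname{Spec}R$ let $F_{\mathfrak p}$ be the functor determined by $(F_{\mathfrak p})^*(X)=F^*(X)_{\mathfrak p}$, the localisation at the homogeneous elements of $R\setminus\mathfrak p$. Let $\mathsf T_{\mathcal V(\mathfrak p)}\subseteq\mathsf T$ be the full subcategory of the objects $X$ such that $\operatorname{End}^*_{\mathsf T}(X)_{\mathfrak q}=0$ for all $\mathfrak q\in\operatorname{Spec}R\setminus\mathcal V(\mathfrak p)$, and set $$\Gamma_{\mathcal V(\mathfrak p)}F=\operatorname{colim}_{H_S\to F}H_S ,$$ where the colimit is taken over the category of pairs of an object $S\in\mathsf T_{\mathcal V(\mathfrak p)}$ and a morphism $H_S\to F$. Finally, set $\Gamma_{\mathfrak p}F=\Gamma_{\mathcal V(\mathfrak p)}(F_{\mathfrak p})$ and $$\operatorname{supp}_RF=\{\mathfrak p\in\operatorname{Spec}R\mid \Gamma_{\mathfrak p}F\neq0\}.$$ Then for every $F\in\operatorname{\mathsf{Coh}}\mathsf T$ one has $\operatorname{supp}_RF=\varnothing$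 if and only if $F=0$. -/

import Mathlib

open CategoryTheory CategoryTheory.Limits CategoryTheory.Pretriangulated Opposite
open scoped CategoryTheory.Pretriangulated.Opposite

universe w u

namespace CohSupport

section GradedRings

/-- A `ℤ`-graded ring is graded commutative if `r * s = (-1) ^ (|r| |s|) s * r` for all homogeneous
elements `r` and `s`. -/
def IsGradedCommutative {R : Type w} [Ring R] (𝒜 : ℤ → AddSubgroup R) : Prop :=
  ∀ (m n : ℤ) (r s : R), r ∈ 𝒜 m → s ∈ 𝒜 n → r * s = (m * n).negOnePow • (s * r)

/-- A homogeneous prime ideal of a `ℤ`-graded ring. It is a proper homogeneous ideal `p` such that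
`r * s ∈ p` implies `r ∈ p` or `s ∈ p` for homogeneous elements `r` and `s`. (In a graded
commutative ring, homogeneous left ideals are two-sided.) These form `Spec R`. -/
structure HomogeneousPrime {R : Type w} [Ring R] (𝒜 : ℤ → AddSubgroup R) [GradedRing 𝒜] where
  /-- the underlying homogeneous ideal -/
  ideal : HomogeneousIdeal 𝒜
  one_notMem : (1 : R) ∉ ideal
  mem_or_mem : ∀ (m n : ℤ) (r s : R), r ∈ 𝒜 m → s ∈ 𝒜 n → r * s ∈ ideal → r ∈ ideal ∨ s ∈ ideal

/-- `V(a)`, the set of homogeneous primes containing the homogeneous ideal `a`. -/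
def zeroLocus {R : Type w} [Ring R] {𝒜 : ℤ → AddSubgroup R} [GradedRing 𝒜]
    (a : HomogeneousIdeal 𝒜) : Set (HomogeneousPrime 𝒜) :=
  {q | a ≤ q.ideal}

/-- The homogeneous elements of `R ∖ p`, together with their degrees. -/
structure Denominator {R : Type w} [Ring R] {𝒜 : ℤ → AddSubgroup R} [GradedRing 𝒜]
    (p : HomogeneousPrime 𝒜) where
  /-- the degree -/
  deg : ℤ
  /-- the element -/
  val : R
  mem : val ∈ 𝒜 deg
  notMem : val ∉ p.ideal

/-- The category of denominators: a morphism `s ⟶ t` is a homogeneous element `r` of degree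
`|t| - |s|` such that `r * s = t`, and composition is multiplication. -/
instance {R : Type w} [Ring R] {𝒜 : ℤ → AddSubgroup R} [GradedRing 𝒜]
    (p : HomogeneousPrime 𝒜) : SmallCategory (Denominator p) where
  Hom s t := {r : R // r ∈ 𝒜 (t.deg - s.deg) ∧ r * s.val = t.val}
  id s := ⟨1, by simpa using SetLike.GradedOne.one_mem (A := 𝒜), one_mul _⟩
  comp {s t u} f g := ⟨g.1 * f.1, by
    have h := SetLike.GradedMul.mul_mem (A := 𝒜) g.2.1 f.2.1
    rwa [sub_add_sub_cancel] at h, by rw [mul_assoc, f.2.2, g.2.2]⟩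
  id_comp f := Subtype.ext (mul_one f.1)
  comp_id f := Subtype.ext (one_mul f.1)
  assoc f g h := Subtype.ext (mul_assoc h.1 g.1 f.1).symm

end GradedRings

section Actions

variable (T : Type u) [Category.{w} T] [Preadditive T] [HasShift T ℤ]
  [∀ n : ℤ, (shiftFunctor T n).Additive]

/-- The degree `n` component `{η : Id ⟶ Σⁿ | η Σ = (-1)ⁿ Σ η}` of the graded centre of `T`. -/
def gradedCentre (n : ℤ) : AddSubgroup (𝟭 T ⟶ shiftFunctor T n) where
  carrier := {η | ∀ X : T, η.app (X⟦(1 : ℤ)⟧) ≫ (shiftComm X (1 : ℤ) n).hom =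
    n.negOnePow • (η.app X)⟦(1 : ℤ)⟧'}
  zero_mem' X := by simp
  add_mem' {η θ} hη hθ X := by
    have h₁ := hη X
    have h₂ := hθ X
    simp only [NatTrans.app_add, Functor.map_add, Preadditive.add_comp, smul_add] at *
    rw [h₁, h₂]
  neg_mem' {η} hη X := by
    have h := hη X
    simp only [NatTrans.app_neg, Functor.map_neg, Preadditive.neg_comp, smul_neg] at *
    rw [h]

/-- An action of the graded ring `R` on `T`, that is, a homomorphism of graded rings from `R` to
the graded centre of `T`. The product of the graded centre is computed in the graded endomorphism
rings `End^*(X)`, whose elements of degree `n` are the morphisms `X ⟶ X⟦n⟧`: the product of `α` of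
degree `m` and `β` of degree `n` is the composite `X ⟶ X⟦n⟧ ⟶ X⟦m⟧⟦n⟧ ≅ X⟦m + n⟧` of `β` and
`α⟦n⟧`. -/
structure CentralAction {R : Type w} [Ring R] (𝒜 : ℤ → AddSubgroup R) [GradedRing 𝒜] where
  /-- the action of the elements of degree `n` -/
  hom (n : ℤ) : 𝒜 n →+ gradedCentre T n
  hom_one (X : T) : (hom 0 ⟨1, SetLike.GradedOne.one_mem⟩).1.app X =
    (shiftFunctorZero T ℤ).inv.app X
  hom_mul (m n : ℤ) (r : 𝒜 m) (s : 𝒜 n) (X : T) :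
    (hom (m + n) ⟨r * s, SetLike.GradedMul.mul_mem r.2 s.2⟩).1.app X =
      ShiftedHom.comp ((hom n s).1.app X : ShiftedHom X X n)
        ((hom m r).1.app X : ShiftedHom X X m) rfl

end Actions

section Localisation

variable {T : Type u} [Category.{w} T] [Preadditive T] [HasShift T ℤ]
  [∀ n : ℤ, (shiftFunctor T n).Additive]
  {R : Type w} [Ring R] {𝒜 : ℤ → AddSubgroup R} [GradedRing 𝒜]

/-- For `r` of degree `e` and `b + e = a`, the natural morphism `X⟦b⟧ ⟶ X⟦b⟧⟦e⟧ ≅ X⟦a⟧` given by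
the action of `r`. For a functor `F : Tᵒᵖ ⥤ Ab`, applying `F` yields multiplication by `r`, from
`F(X⟦a⟧)`, the degree `-a` part of `F^*(X)`, to `F(X⟦b⟧)`, the part of degree `-a + e`. -/
noncomputable def CentralAction.act (φ : CentralAction T 𝒜) {e : ℤ} (r : 𝒜 e) (b a : ℤ)
    (h : b + e = a) : shiftFunctor T b ⟶ shiftFunctor T a :=
  Functor.whiskerLeft (shiftFunctor T b) (φ.hom e r).1 ≫ (shiftFunctorAdd' T b e a h).inv

lemma CentralAction.act_app (φ : CentralAction T 𝒜) {e : ℤ} (r : 𝒜 e) (b a : ℤ)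
    (h : b + e = a) (X : T) : (φ.act r b a h).app X =
      (φ.hom e r).1.app (X⟦b⟧) ≫ (shiftFunctorAdd' T b e a h).inv.app X := rfl

lemma CentralAction.act_one (φ : CentralAction T 𝒜) (b e : ℤ) (he : e = 0) (h : b + e = b)
    (h1 : (1 : R) ∈ 𝒜 e) : φ.act ⟨1, h1⟩ b b h = 𝟙 _ := by
  subst he
  ext X
  rw [act_app, φ.hom_one, shiftFunctorAdd'_add_zero_inv_app]
  simp

lemma CentralAction.act_mul (φ : CentralAction T 𝒜) {d e f : ℤ} (r : 𝒜 d) (s : 𝒜 e)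
    (hf : d + e = f) (hrs : (r : R) * s ∈ 𝒜 f) (a b c : ℤ) (hs : b + e = a) (hr : c + d = b)
    (h : c + f = a) : φ.act ⟨r * s, hrs⟩ c a h = φ.act r c b hr ≫ φ.act s b a hs := by
  subst hf
  ext X
  rw [NatTrans.comp_app, act_app, act_app, act_app, φ.hom_mul]
  have n1 := (φ.hom e s).1.naturality ((shiftFunctorAdd' T c d b hr).inv.app X)
  have n2 := (φ.hom e s).1.naturality ((φ.hom d r).1.app (X⟦c⟧))
  simp only [Functor.id_map, Functor.id_obj] at n1 n2
  simp only [ShiftedHom.comp, Category.assoc]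
  erw [reassoc_of% n1, reassoc_of% n2]
  congr 2
  exact (shiftFunctorAdd'_assoc_inv_app c d e b (d + e) a hr rfl (by omega) X).symm

/-- The diagram `s ↦ F(X⟦-|s|⟧) = F^{|s|}(X)` indexed by the homogeneous elements `s` of `R ∖ p`,
in which a morphism `r : s ⟶ t` acts as multiplication by `r`. -/
noncomputable def fractionDiagram (φ : CentralAction T 𝒜) (p : HomogeneousPrime 𝒜)
    (F : Tᵒᵖ ⥤ AddCommGrpCat.{w}) : Denominator p ⥤ (Tᵒᵖ ⥤ AddCommGrpCat.{w}) where
  obj s := (shiftFunctor T (-s.deg)).op ⋙ F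
  map {s t} r := Functor.whiskerRight
    (NatTrans.op (φ.act ⟨r.1, r.2.1⟩ (-t.deg) (-s.deg) (by omega))) F
  map_id s := by
    have h := φ.act_one (-s.deg) (s.deg - s.deg) (by omega) (by omega) (𝟙 s : s ⟶ s).2.1
    ext X : 2
    dsimp only [Functor.whiskerRight_app, NatTrans.op_app]
    erw [h]
    simp
  map_comp {s t v} f g := by
    have h := φ.act_mul ⟨g.1, g.2.1⟩ ⟨f.1, f.2.1⟩ (by omega) (f ≫ g).2.1
      (-s.deg) (-t.deg) (-v.deg) (by omega) (by omega) (by omega)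
    ext X : 2
    dsimp only [Functor.whiskerRight_app, NatTrans.op_app, NatTrans.comp_app]
    rw [← F.map_comp, ← op_comp, ← NatTrans.comp_app]
    erw [h]

/-- The localisation `F_p` of `F` at the homogeneous prime `p`, determined by
`(F_p)^*(X) = F^*(X)_p`. The group `F_p(X)` is the degree zero part of `F^*(X)_p`: it consists of
the fractions `x / s` with `s ∈ R ∖ p` homogeneous and `x ∈ F^{|s|}(X)`, which means that it is the
(filtered) colimit over all such `s` of the groups `F^{|s|}(X)`, where `x` at `s` is identified
with `r x` at `r s`. -/
noncomputable def localize (φ : CentralAction T 𝒜) (p : HomogeneousPrime 𝒜)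
    (F : Tᵒᵖ ⥤ AddCommGrpCat.{w}) : Tᵒᵖ ⥤ AddCommGrpCat.{w} :=
  colimit (fractionDiagram φ p F)

/-- The full subcategory `T_V` of the objects `X` such that `End^*(X)_q = 0` for all `q ∉ V`. Here
`End^*(X) = H_X^*(X)` with `H_X = Hom(-, X)`, and the degree `n` part of `H_X^*(X)_q` is
`(H_X)_q(X⟦-n⟧)`. -/
def torsionObjects (φ : CentralAction T 𝒜) (V : Set (HomogeneousPrime 𝒜)) : ObjectProperty T :=
  fun X => ∀ q : HomogeneousPrime 𝒜, q ∉ V → ∀ n : ℤ,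
    IsZero ((localize φ q (preadditiveYoneda.obj X)).obj (op (X⟦-n⟧)))

end Localisation

section Extension

instance locallySmall_functors {C : Type u} [Category.{w} C] [EssentiallySmall.{w} C] :
    LocallySmall.{w} (Cᵒᵖ ⥤ AddCommGrpCat.{w}) :=
  locallySmall_of_faithful
    ((Functor.whiskeringLeft _ _ AddCommGrpCat.{w}).obj (equivSmallModel.{w} C).inverse.op)

instance essentiallySmall_fullSubcategory {C : Type u} [Category.{w} C] [EssentiallySmall.{w} C]
    (S : ObjectProperty C) : EssentiallySmall.{w} S.FullSubcategory :=
  essentiallySmall_of_fully_faithful S.ι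

instance essentiallySmall_slice {C : Type u} [Category.{w} C] [Preadditive C]
    [EssentiallySmall.{w} C] (F : Cᵒᵖ ⥤ AddCommGrpCat.{w}) :
    EssentiallySmall.{w} (CostructuredArrow (preadditiveYoneda (C := C)) F) :=
  inferInstance

/-- The functor `f_*(G) = G ∘ f`. -/
abbrev pushforward {C : Type u} {D : Type u} [Category.{w} C] [Category.{w} D]
    (f : C ⥤ D) (G : Dᵒᵖ ⥤ AddCommGrpCat.{w}) : Cᵒᵖ ⥤ AddCommGrpCat.{w} :=
  f.op ⋙ G

/-- The functor `f^*(F) = colim_{H_X → F} H_{f(X)}`, the colimit over the slice category of pairs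
of an object `X` and a morphism `H_X = Hom(-, X) ⟶ F`. -/
noncomputable def pullback {C : Type u} {D : Type u} [Category.{w} C] [Preadditive C]
    [EssentiallySmall.{w} C] [Category.{w} D] [Preadditive D]
    (f : C ⥤ D) (F : Cᵒᵖ ⥤ AddCommGrpCat.{w}) : Dᵒᵖ ⥤ AddCommGrpCat.{w} :=
  haveI : HasColimitsOfShape (CostructuredArrow (preadditiveYoneda (C := C)) F)
      AddCommGrpCat.{w} := hasColimitsOfShape_of_equivalence (equivSmallModel.{w} _).symm
  colimit (CostructuredArrow.proj preadditiveYoneda F ⋙ f ⋙ preadditiveYoneda)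

/-- The colocalisation functor `Γ = i^* ∘ i_*`, for the inclusion `i` of a full subcategory `S`. -/
noncomputable def colocalize {T : Type u} [Category.{w} T] [Preadditive T] [EssentiallySmall.{w} T]
    (S : ObjectProperty T) (F : Tᵒᵖ ⥤ AddCommGrpCat.{w}) : Tᵒᵖ ⥤ AddCommGrpCat.{w} :=
  pullback S.ι (pushforward S.ι F)

end Extension

section Support

variable {T : Type u} [Category.{w} T] [Preadditive T] [HasShift T ℤ]
  [∀ n : ℤ, (shiftFunctor T n).Additive] [EssentiallySmall.{w} T]
  {R : Type w} [Ring R] {𝒜 : ℤ → AddSubgroup R} [GradedRing 𝒜]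

/-- `Γ_V`, the colocalisation functor given by the inclusion of `T_V` into `T`. -/
noncomputable def gammaSet (φ : CentralAction T 𝒜) (V : Set (HomogeneousPrime 𝒜))
    (F : Tᵒᵖ ⥤ AddCommGrpCat.{w}) : Tᵒᵖ ⥤ AddCommGrpCat.{w} :=
  colocalize (torsionObjects φ V) F

/-- `Γ_p F = Γ_{V(p)}(F_p)`. -/
noncomputable def gammaPrime (φ : CentralAction T 𝒜) (p : HomogeneousPrime 𝒜)
    (F : Tᵒᵖ ⥤ AddCommGrpCat.{w}) : Tᵒᵖ ⥤ AddCommGrpCat.{w} :=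
  gammaSet φ (zeroLocus p.ideal) (localize φ p F)

/-- The support of `F`: the set of homogeneous primes `p` with `Γ_p F ≠ 0`. -/
def supp (φ : CentralAction T 𝒜) (F : Tᵒᵖ ⥤ AddCommGrpCat.{w}) : Set (HomogeneousPrime 𝒜) :=
  {p | ¬ IsZero (gammaPrime φ p F)}

end Support

end CohSupport

/-! Suppose `F ≠ 0`. Since `R` is noetherian, among all pairs of an object `Y` and a nonzero `y ∈
F(Y)` there is one for which the radical `p` of the annihilator of `Y` is maximal. The key step is
`exists_radical_annihilator_le`: if a homogeneous `r` kills a nonzero element of `F^*(Y)`, then that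
element lifts to `F(Z)`, where `Z` is the cone of `r` acting on a shift of `Y`. Some power of `r`,
and of each homogeneous element of `p`, kills `Z`, so maximality forces `r ∈ p`.

This has two consequences (`exists_prime_eq_radical_annihilator`). The ideal `p` is prime: if `r ^ k
* s ^ k` kills `Y`, then either `s ^ k` kills `y`, or `r ^ k` kills the nonzero element `s ^ k y`.
Moreover nothing outside `p` kills `y`, so `y` stays nonzero in `F_p`
(`exists_act_eq_zero_of_toLocalize`). As `Y` lies in `T_{V(p)}` (`mem_torsionObjects_of_pow_mem`),
the nonzero map `H_Y ⟶ F ⟶ F_p` is detected by `Γ_p F` (`not_isZero_colocalize`), so `p` is in the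
support.

Conversely, `F = 0` gives `F_p = 0`, and `Γ` preserves zero because `T_{V(p)}` contains a zero
object. -/

namespace CohSupport

/-! ### Homogeneous ideals, radicals and denominators in a graded commutative ring. -/

section GradedRings

variable {R : Type w} [Ring R] {𝒜 : ℤ → AddSubgroup R} [GradedRing 𝒜]

/-- The homogeneous ideal whose homogeneous elements of degree `n` are those satisfying `S n`. -/
def idealOfHomogeneous (S : ℤ → R → Prop) (zero : ∀ n, S n 0)
    (add : ∀ n r s, r ∈ 𝒜 n → s ∈ 𝒜 n → S n r → S n s → S n (r + s))
    (mul : ∀ m n r s, r ∈ 𝒜 m → s ∈ 𝒜 n → S n s → S (m + n) (r * s)) :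
    HomogeneousIdeal 𝒜 where
  toSubmodule :=
    { carrier := {x | ∀ n, S n (DirectSum.decompose 𝒜 x n)}
      zero_mem' := fun n => by simpa using zero n
      add_mem' := fun {x y} hx hy n => by
        rw [DirectSum.decompose_add, DirectSum.add_apply, AddSubgroup.coe_add]
        exact add n _ _ (SetLike.coe_mem _) (SetLike.coe_mem _) (hx n) (hy n)
      smul_mem' := fun c x hx => by
        induction c using DirectSum.Decomposition.inductionOn 𝒜 with
        | zero => intro n; simpa using zero n
        | @homogeneous i r =>
          intro n
          obtain ⟨j, rfl⟩ : ∃ j, n = i + j := ⟨n - i, by omega⟩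
          rw [smul_eq_mul, DirectSum.coe_decompose_mul_add_of_left_mem 𝒜 r.2]
          exact mul _ _ _ _ r.2 (SetLike.coe_mem _) (hx j)
        | add a b ha hb =>
          intro n
          rw [add_smul, DirectSum.decompose_add, DirectSum.add_apply, AddSubgroup.coe_add]
          exact add n _ _ (SetLike.coe_mem _) (SetLike.coe_mem _) (ha n) (hb n) }
  is_homogeneous' := fun i x hx n => by
    by_cases h : i = n
    · subst h
      rw [DirectSum.decompose_of_mem_same 𝒜 (SetLike.coe_mem _)]
      exact hx i
    · rw [DirectSum.decompose_of_mem_ne 𝒜 (SetLike.coe_mem _) h]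
      exact zero n

lemma mem_idealOfHomogeneous {S : ℤ → R → Prop} (zero : ∀ n, S n 0)
    (add : ∀ n r s, r ∈ 𝒜 n → s ∈ 𝒜 n → S n r → S n s → S n (r + s))
    (mul : ∀ m n r s, r ∈ 𝒜 m → s ∈ 𝒜 n → S n s → S (m + n) (r * s))
    {n : ℤ} {r : R} (hr : r ∈ 𝒜 n) :
    r ∈ idealOfHomogeneous S zero add mul ↔ S n r := by
  change (∀ m, S m (DirectSum.decompose 𝒜 r m)) ↔ _
  constructor
  · intro h
    have := h n
    rwa [DirectSum.decompose_of_mem_same 𝒜 hr] at this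
  · intro h m
    by_cases hm : n = m
    · subst hm
      rwa [DirectSum.decompose_of_mem_same 𝒜 hr]
    · rw [DirectSum.decompose_of_mem_ne 𝒜 hr hm]
      exact zero m

lemma units_smul_mem (K : HomogeneousIdeal 𝒜) (u : ℤˣ) {x : R} (hx : x ∈ K) : u • x ∈ K := by
  rcases Int.units_eq_one_or u with rfl | rfl
  · simpa using hx
  · rw [Units.neg_smul, one_smul]
    exact K.toIdeal.neg_mem hx

/-- Homogeneous left ideals of a graded commutative ring are two-sided. -/
lemma IsGradedCommutative.isTwoSided (h𝒜 : IsGradedCommutative 𝒜) (K : HomogeneousIdeal 𝒜) :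
    K.toIdeal.IsTwoSided where
  mul_mem_of_left {a} b ha := by
    classical
    induction b using DirectSum.Decomposition.inductionOn 𝒜 with
    | zero => simp
    | @homogeneous i s =>
      rw [← DirectSum.sum_support_decompose 𝒜 a, Finset.sum_mul]
      refine K.toIdeal.sum_mem fun n _ => ?_
      rw [h𝒜 n i _ _ (SetLike.coe_mem _) s.2]
      exact units_smul_mem K _ (K.toIdeal.mul_mem_left _ (K.isHomogeneous n ha))
    | add b c hb hc =>
      rw [mul_add]
      exact K.toIdeal.add_mem hb hc

/-- Each exchange of factors costs only a sign, and ideals do not see signs. -/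
lemma IsGradedCommutative.exists_mul_pow (h𝒜 : IsGradedCommutative 𝒜) {m n : ℤ} {r s : R}
    (hr : r ∈ 𝒜 m) (hs : s ∈ 𝒜 n) (k : ℕ) : ∃ u : ℤˣ, (r * s) ^ k = u • (r ^ k * s ^ k) := by
  induction k with
  | zero => exact ⟨1, by simp⟩
  | succ k ih =>
    obtain ⟨u, hu⟩ := ih
    have h := h𝒜 _ _ _ _ (SetLike.pow_mem_graded k hs) hr
    refine ⟨u * (k • n * m).negOnePow, ?_⟩
    calc (r * s) ^ (k + 1) = u • (r ^ k * (s ^ k * r) * s) := by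
          rw [pow_succ, hu, smul_mul_assoc]; simp only [mul_assoc]
      _ = _ := by
          rw [h, mul_smul, mul_smul_comm, smul_mul_assoc, pow_succ, pow_succ]
          simp only [mul_assoc]

/-- If `r` and `s` anticommute, the cross terms of `(r + s) ^ 2` cancel and the squares commute,
which reduces to the commuting case. -/
lemma isNilpotent_add_of_mul_eq_units_smul {S : Type*} [Ring S] {r s : S} (u : ℤˣ)
    (h : r * s = u • (s * r)) (hr : IsNilpotent r) (hs : IsNilpotent s) :
    IsNilpotent (r + s) := by
  rcases Int.units_eq_one_or u with rfl | rfl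
  · exact Commute.isNilpotent_add (show r * s = s * r by simpa using h) hr hs
  · rw [Units.neg_smul, one_smul] at h
    have hc : Commute (r ^ 2) (s ^ 2) := by
      have h2 : Commute (r ^ 2) s := by
        change r ^ 2 * s = s * r ^ 2
        rw [pow_two, mul_assoc, h, mul_neg, ← mul_assoc, h, neg_mul, neg_neg, mul_assoc]
      exact h2.pow_right 2
    have hsq : (r + s) ^ 2 = r ^ 2 + s ^ 2 := by
      simp only [pow_two, add_mul, mul_add, h]
      abel
    obtain ⟨k, hk⟩ := hc.isNilpotent_add (hr.pow_of_pos two_ne_zero) (hs.pow_of_pos two_ne_zero)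
    exact ⟨2 * k, by rw [pow_mul, hsq, hk]⟩

/-- The radical of a homogeneous ideal in a graded commutative ring. -/
def IsGradedCommutative.radical (h𝒜 : IsGradedCommutative 𝒜) (K : HomogeneousIdeal 𝒜) :
    HomogeneousIdeal 𝒜 :=
  idealOfHomogeneous (fun _ r => ∃ k : ℕ, r ^ k ∈ K)
    (fun _ => ⟨1, by simp⟩)
    (fun n r s hr hs ⟨k, hk⟩ ⟨l, hl⟩ => by
      have := h𝒜.isTwoSided K
      -- Modulo `K`, closure under sums becomes nilpotency of a sum; two elements of the same degree
      -- `n` commute up to the sign of `n * n`.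
      have key : IsNilpotent (Ideal.Quotient.mk K.toIdeal r + Ideal.Quotient.mk K.toIdeal s) :=
        isNilpotent_add_of_mul_eq_units_smul (n * n).negOnePow
          (by rw [← map_mul, h𝒜 n n r s hr hs, Units.smul_def, map_zsmul, map_mul]; rfl)
          ⟨k, by rw [← map_pow]; exact Ideal.Quotient.eq_zero_iff_mem.2 hk⟩
          ⟨l, by rw [← map_pow]; exact Ideal.Quotient.eq_zero_iff_mem.2 hl⟩
      obtain ⟨N, hN⟩ := key
      rw [← map_add, ← map_pow] at hN
      exact ⟨N, Ideal.Quotient.eq_zero_iff_mem.1 hN⟩)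
    (fun m n r s hr hs ⟨k, hk⟩ => by
      obtain ⟨u, hu⟩ := h𝒜.exists_mul_pow hr hs k
      exact ⟨k, hu ▸ units_smul_mem K u (K.toIdeal.mul_mem_left _ hk)⟩)

lemma IsGradedCommutative.mem_radical (h𝒜 : IsGradedCommutative 𝒜) {K : HomogeneousIdeal 𝒜}
    {n : ℤ} {r : R} (hr : r ∈ 𝒜 n) : r ∈ h𝒜.radical K ↔ ∃ k : ℕ, r ^ k ∈ K :=
  mem_idealOfHomogeneous _ _ _ hr

lemma homogeneousIdeal_le_iff {I J : HomogeneousIdeal 𝒜} :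
    I ≤ J ↔ ∀ n, ∀ r ∈ 𝒜 n, r ∈ I → r ∈ J := by
  classical
  refine ⟨fun h n r _ hr => h hr, fun h x hx => ?_⟩
  rw [← DirectSum.sum_support_decompose 𝒜 x]
  exact J.toIdeal.sum_mem fun n _ => h n _ (SetLike.coe_mem _) (I.isHomogeneous n hx)

lemma HomogeneousPrime.mul_notMem (p : HomogeneousPrime 𝒜) {m n : ℤ} {r s : R} (hr : r ∈ 𝒜 m)
    (hs : s ∈ 𝒜 n) (hrp : r ∉ p.ideal) (hsp : s ∉ p.ideal) : r * s ∉ p.ideal :=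
  fun h => (p.mem_or_mem m n r s hr hs h).elim hrp hsp

lemma HomogeneousPrime.pow_notMem (p : HomogeneousPrime 𝒜) {n : ℤ} {r : R} (hr : r ∈ 𝒜 n)
    (hrp : r ∉ p.ideal) (k : ℕ) : r ^ k ∉ p.ideal := by
  induction k with
  | zero => simpa using p.one_notMem
  | succ k ih =>
    rw [pow_succ]
    exact p.mul_notMem (SetLike.pow_mem_graded k hr) hr ih hrp

/-- The denominator `1`. -/
def Denominator.one (p : HomogeneousPrime 𝒜) : Denominator p :=
  ⟨0, 1, SetLike.GradedOne.one_mem, p.one_notMem⟩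

lemma IsGradedCommutative.isFiltered_denominator (h𝒜 : IsGradedCommutative 𝒜)
    (p : HomogeneousPrime 𝒜) : IsFiltered (Denominator p) where
  nonempty := ⟨.one p⟩
  cocone_objs s t := by
    refine ⟨⟨t.deg + s.deg, t.val * s.val, SetLike.GradedMul.mul_mem t.mem s.mem,
      p.mul_notMem t.mem s.mem t.notMem s.notMem⟩, ⟨t.val, ?_, rfl⟩,
      ⟨(t.deg * s.deg).negOnePow • s.val, ?_, ?_⟩, trivial⟩
    · simpa using t.mem
    · rw [Units.smul_def]
      exact zsmul_mem (by simpa using s.mem) _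
    · rw [smul_mul_assoc, ← h𝒜 _ _ _ _ t.mem s.mem]
  cocone_maps s t f g := by
    refine ⟨⟨s.deg + t.deg, s.val * t.val, SetLike.GradedMul.mul_mem s.mem t.mem,
      p.mul_notMem s.mem t.mem s.notMem t.notMem⟩, ⟨s.val, by simpa using s.mem, rfl⟩,
      Subtype.ext ?_⟩
    -- `s.val` coequalizes: `f` and `g` have the same degree, so both products are the same sign
    -- times `t.val`.
    change s.val * f.1 = s.val * g.1
    rw [h𝒜 _ _ _ _ s.mem f.2.1, h𝒜 _ _ _ _ s.mem g.2.1, f.2.2, g.2.2]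

end GradedRings

/-! ### Signs under shifts, and annihilators of objects. -/

section Annihilators

/-- Coherence of the shifts: `e` moves past `n` and `1` separately or past `n + 1` at once. -/
lemma shiftComm_comp_shift_shiftComm {T : Type u} [Category.{w} T] [HasShift T ℤ]
    (n e : ℤ) (X : T) :
    (shiftComm (X⟦n⟧) 1 e).hom ≫ ((shiftComm X n e).hom)⟦(1 : ℤ)⟧' =
      ((shiftFunctorAdd T n 1).inv.app X)⟦e⟧' ≫ (shiftComm X (n + 1) e).hom ≫
        (shiftFunctorAdd T n 1).hom.app (X⟦e⟧) := by
  have h := shiftFunctorComm_hom_app_comp_shift_shiftFunctorAdd_hom_app e n 1 X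
  have e₁ : ∀ (Y : T) (i : ℤ), (shiftComm Y i e).hom = (shiftFunctorComm T e i).inv.app Y := by
    intro Y i
    rw [← shiftComm_symm]
    rfl
  rw [e₁, e₁, e₁, ← cancel_epi ((shiftFunctorComm T e 1).hom.app (X⟦n⟧)),
    Iso.hom_inv_id_app_assoc, ← cancel_epi (((shiftFunctorComm T e n).hom.app X)⟦(1 : ℤ)⟧'),
    ← cancel_epi ((shiftFunctorAdd T n 1).hom.app (X⟦e⟧)), ← Functor.map_comp,
    Iso.hom_inv_id_app, ← reassoc_of% h, ← Functor.map_comp_assoc, Iso.hom_inv_id_app]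
  simp

variable {T : Type u} [Category.{w} T] [Preadditive T] [HasShift T ℤ]
  [∀ n : ℤ, (shiftFunctor T n).Additive]

/-- Both morphisms compared in `gradedCentre_app_shift` are carried from `n` to `n + 1` by the same
isomorphisms, up to the sign in the definition of the graded centre. Hiding these isomorphisms lets
the induction run in both directions. -/
lemma gradedCentre_app_shift_succ {e : ℤ} (η : gradedCentre T e) (n : ℤ) (X : T) :
    ∃ (α : X⟦n⟧⟦(1 : ℤ)⟧ ⟶ X⟦n + 1⟧) (β : X⟦e⟧⟦n + 1⟧ ⟶ X⟦e⟧⟦n⟧⟦(1 : ℤ)⟧) (_ : IsIso α)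
      (_ : IsIso β),
      (η.1.app (X⟦n⟧) ≫ (shiftComm X n e).hom)⟦(1 : ℤ)⟧' =
        e.negOnePow • (α ≫ (η.1.app (X⟦n + 1⟧) ≫ (shiftComm X (n + 1) e).hom) ≫ β) ∧
      (η.1.app X)⟦n⟧'⟦(1 : ℤ)⟧' = α ≫ (η.1.app X)⟦n + 1⟧' ≫ β := by
  refine ⟨(shiftFunctorAdd T n 1).inv.app X, (shiftFunctorAdd T n 1).hom.app (X⟦e⟧),
    inferInstance, inferInstance, ?_, ?_⟩
  · have h := η.2 (X⟦n⟧)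
    have h' : (η.1.app (X⟦n⟧))⟦(1 : ℤ)⟧' = e.negOnePow •
        (η.1.app (X⟦n⟧⟦(1 : ℤ)⟧) ≫ (shiftComm (X⟦n⟧) 1 e).hom) := by
      erw [h]
      rw [smul_smul, Int.units_mul_self, one_smul]
    have n1 := η.1.naturality ((shiftFunctorAdd T n 1).inv.app X)
    dsimp at n1
    rw [Functor.map_comp, h', Category.assoc, reassoc_of% n1, Units.smul_def,
      Linear.smul_comp, Category.assoc, shiftComm_comp_shift_shiftComm, ← Units.smul_def]
  · have n1 := (shiftFunctorAdd T n 1).hom.naturality (η.1.app X)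
    dsimp at n1
    rw [n1, Iso.inv_hom_id_app_assoc]

/-- An element of the graded centre commutes with every shift up to sign. -/
lemma gradedCentre_app_shift {e : ℤ} (η : gradedCentre T e) (n : ℤ) (X : T) :
    ∃ u : ℤˣ, η.1.app (X⟦n⟧) ≫ (shiftComm X n e).hom = u • (η.1.app X)⟦n⟧' := by
  -- An equivalence is needed to reach negative `n`; the downward direction uses that the shift is
  -- faithful.
  have key : ∀ n : ℤ, (∃ u : ℤˣ, η.1.app (X⟦n⟧) ≫ (shiftComm X n e).hom =
      u • (η.1.app X)⟦n⟧') ↔ ∃ u : ℤˣ, η.1.app (X⟦n + 1⟧) ≫ (shiftComm X (n + 1) e).hom =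
        u • (η.1.app X)⟦n + 1⟧' := by
    intro n
    obtain ⟨α, β, _, _, h₁, h₂⟩ := gradedCentre_app_shift_succ η n X
    constructor
    · rintro ⟨u, hu⟩
      refine ⟨e.negOnePow * u, ?_⟩
      rw [hu, Units.smul_def, Functor.map_zsmul, h₂] at h₁
      rw [← cancel_epi α, ← cancel_mono β, mul_smul, Units.smul_def, Units.smul_def]
      simp only [Linear.smul_comp, Linear.comp_smul, Category.assoc] at h₁ ⊢
      rw [h₁, ← Units.smul_def, smul_smul, Int.units_mul_self, one_smul]
    · rintro ⟨u, hu⟩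
      refine ⟨e.negOnePow * u, (shiftFunctor T (1 : ℤ)).map_injective ?_⟩
      rw [h₁, hu, mul_smul]
      simp only [Units.smul_def, Functor.map_zsmul, h₂, Linear.smul_comp, Linear.comp_smul]
  induction n using Int.induction_on with
  | zero =>
    refine ⟨1, ?_⟩
    rw [one_smul]
    have h := (shiftFunctorZero T ℤ).hom.naturality (η.1.app X)
    have n1 := η.1.naturality ((shiftFunctorZero T ℤ).hom.app X)
    dsimp at h n1
    rw [← shiftComm_symm, ← cancel_mono ((shiftFunctorZero T ℤ).hom.app (X⟦e⟧)), h,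
      shiftFunctorZero_hom_app_shift, n1, Iso.symm_hom, Category.assoc]
    congr 1
    exact (shiftComm X e 0).inv_hom_id_assoc _
  | succ n ih => exact (key _).1 ih
  | pred n ih => exact (key _).2 (by rwa [sub_add_cancel])

variable {R : Type w} [Ring R] {𝒜 : ℤ → AddSubgroup R} [GradedRing 𝒜]

/-- A homogeneous element of `R` annihilates an object if it acts on it as zero. -/
def CentralAction.Kills (φ : CentralAction T 𝒜) {e : ℤ} (r : 𝒜 e) (X : T) : Prop :=
  (φ.hom e r).1.app X = 0

variable {φ : CentralAction T 𝒜}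

/-- By naturality the factors of the product may be composed in either order, and the final shift
isomorphism does not affect vanishing. -/
lemma CentralAction.kills_mul_iff {m n : ℤ} (r : 𝒜 m) (s : 𝒜 n) (X : T)
    (h : (r : R) * s ∈ 𝒜 (m + n)) : φ.Kills ⟨r * s, h⟩ X ↔
      (φ.hom m r).1.app X ≫ (φ.hom n s).1.app (X⟦m⟧) = 0 := by
  have n1 := (φ.hom n s).1.naturality ((φ.hom m r).1.app X)
  dsimp at n1
  rw [Kills, φ.hom_mul, ShiftedHom.comp, n1, ← Category.assoc, Preadditive.IsIso.comp_right_eq_zero]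

lemma CentralAction.Kills.shift {e : ℤ} {r : 𝒜 e} {X : T} (h : φ.Kills r X) (n : ℤ) :
    φ.Kills r (X⟦n⟧) := by
  obtain ⟨u, hu⟩ := gradedCentre_app_shift (φ.hom e r) n X
  rw [h, Functor.map_zero, smul_zero, Preadditive.IsIso.comp_right_eq_zero] at hu
  exact hu

lemma CentralAction.Kills.act_app_eq_zero {e : ℤ} {r : 𝒜 e} {X : T} (h : φ.Kills r X) (b a : ℤ)
    (hab : b + e = a) : (φ.act r b a hab).app X = 0 := by
  rw [act_app, show (φ.hom e r).1.app (X⟦b⟧) = 0 from h.shift b, zero_comp]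

lemma CentralAction.Kills.mul {m n : ℤ} (r : 𝒜 m) {s : 𝒜 n} {X : T} (hs : φ.Kills s X)
    (h : (r : R) * s ∈ 𝒜 (m + n)) : φ.Kills ⟨r * s, h⟩ X := by
  rw [kills_mul_iff, show (φ.hom n s).1.app (X⟦m⟧) = 0 from hs.shift m, comp_zero]

/-- The annihilator of an object, a homogeneous ideal. -/
def CentralAction.annihilator (φ : CentralAction T 𝒜) (X : T) : HomogeneousIdeal 𝒜 :=
  idealOfHomogeneous (fun n r => ∀ h : r ∈ 𝒜 n, φ.Kills ⟨r, h⟩ X)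
    (fun n h => by
      rw [Kills, show (⟨0, h⟩ : 𝒜 n) = 0 from rfl, map_zero]
      rfl)
    (fun n r s hr hs h₁ h₂ h => by
      have h₁ := h₁ hr
      have h₂ := h₂ hs
      rw [Kills] at *
      rw [show (⟨r + s, h⟩ : 𝒜 n) = ⟨r, hr⟩ + ⟨s, hs⟩ from rfl, map_add, AddSubgroup.coe_add,
        NatTrans.app_add, h₁, h₂, add_zero])
    (fun m n r s hr hs h₂ h => (h₂ hs).mul ⟨r, hr⟩ h)

lemma CentralAction.mem_annihilator {X : T} {n : ℤ} {r : R} (hr : r ∈ 𝒜 n) :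
    r ∈ φ.annihilator X ↔ φ.Kills ⟨r, hr⟩ X :=
  (mem_idealOfHomogeneous _ _ _ hr).trans ⟨fun h => h hr, fun h _ => h⟩

lemma CentralAction.one_mem_annihilator_iff {X : T} :
    (1 : R) ∈ φ.annihilator X ↔ 𝟙 X = 0 := by
  rw [mem_annihilator SetLike.GradedOne.one_mem, Kills, φ.hom_one]
  rw [← Preadditive.IsIso.comp_right_eq_zero (𝟙 X) ((shiftFunctorZero T ℤ).inv.app X)]
  simp

end Annihilators

/-! ### Annihilators along exact triangles. -/

section Cones

variable {T : Type u} [Category.{w} T] [Preadditive T] [HasZeroObject T] [HasShift T ℤ]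
  [∀ n : ℤ, (shiftFunctor T n).Additive] [Pretriangulated T]
  {R : Type w} [Ring R] {𝒜 : ℤ → AddSubgroup R} [GradedRing 𝒜] {φ : CentralAction T 𝒜}

/-- As `r` on `Z` vanishes after `g`, it factors as `δ ≫ k`. Naturality moves `s` across `k` to
`X⟦1⟧`, where it is killed by `δ`. -/
lemma CentralAction.kills_mul_of_distinguished {X Y Z : T} {f : X ⟶ Y} {g : Y ⟶ Z}
    {δ : Z ⟶ X⟦(1 : ℤ)⟧} (hT : Triangle.mk f g δ ∈ distTriang T) {m n : ℤ} {r : 𝒜 m} {s : 𝒜 n}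
    (hg : g ≫ (φ.hom m r).1.app Z = 0) (hδ : δ ≫ (φ.hom n s).1.app (X⟦(1 : ℤ)⟧) = 0)
    (h : (r : R) * s ∈ 𝒜 (m + n)) : φ.Kills ⟨r * s, h⟩ Z := by
  rw [kills_mul_iff]
  obtain ⟨k, hk⟩ : ∃ k : X⟦(1 : ℤ)⟧ ⟶ Z⟦m⟧, (φ.hom m r).1.app Z = δ ≫ k :=
    Triangle.yoneda_exact₃ _ hT ((φ.hom m r).1.app Z) hg
  have n1 : k ≫ (φ.hom n s).1.app _ = (φ.hom n s).1.app (X⟦(1 : ℤ)⟧) ≫ k⟦n⟧' :=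
    (φ.hom n s).1.naturality k
  rw [hk, Category.assoc]
  erw [n1]
  rw [ reassoc_of% hδ, zero_comp]

/-- If `r` annihilates two objects of a triangle, then `r * r` annihilates the third. -/
lemma CentralAction.Kills.mul_self_of_distinguished {X Y Z : T} {f : X ⟶ Y} {g : Y ⟶ Z}
    {δ : Z ⟶ X⟦(1 : ℤ)⟧} (hT : Triangle.mk f g δ ∈ distTriang T) {n : ℤ} {r : 𝒜 n}
    (hX : φ.Kills r X) (hY : φ.Kills r Y) (h : (r : R) * r ∈ 𝒜 (n + n)) :
    φ.Kills ⟨r * r, h⟩ Z := by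
  refine kills_mul_of_distinguished hT ?_ ?_ h
  · have n1 := (φ.hom n r).1.naturality g
    dsimp at n1
    rw [n1, hY, zero_comp]
  · rw [show (φ.hom n r).1.app (X⟦(1 : ℤ)⟧) = 0 from hX.shift 1, comp_zero]

/-- The square of `r` annihilates the cone of the action of `r`. -/
lemma CentralAction.kills_mul_self_cone {X Z : T} {n : ℤ} {r : 𝒜 n} {g : X⟦n⟧ ⟶ Z}
    {δ : Z ⟶ X⟦(1 : ℤ)⟧} (hT : Triangle.mk ((φ.hom n r).1.app X) g δ ∈ distTriang T)
    (h : (r : R) * r ∈ 𝒜 (n + n)) : φ.Kills ⟨r * r, h⟩ Z := by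
  refine kills_mul_of_distinguished hT ?_ ?_ h
  · have n1 := (φ.hom n r).1.naturality g
    dsimp at n1
    obtain ⟨u, hu⟩ := gradedCentre_app_shift (φ.hom n r) n X
    have h0 : (φ.hom n r).1.app X ≫ g = 0 := comp_distTriang_mor_zero₁₂ _ hT
    -- With both shifts equal to `n`, `r` on `X⟦n⟧` is, up to sign, the shift of `r` on `X`, so its
    -- composite with `g⟦n⟧` is a shift of the zero composite in the triangle.
    have : (shiftComm X n n).hom = 𝟙 _ := by simp [shiftComm]
    rw [this] at hu
    erw [Category.comp_id] at hu
    rw [n1, hu, Units.smul_def, Linear.smul_comp, ← Functor.map_comp, h0, Functor.map_zero, smul_zero]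
  · obtain ⟨u, hu⟩ := gradedCentre_app_shift (φ.hom n r) 1 X
    have h0 : δ ≫ ((φ.hom n r).1.app X)⟦(1 : ℤ)⟧' = 0 := comp_distTriang_mor_zero₃₁ _ hT
    rw [← Preadditive.IsIso.comp_right_eq_zero _ (shiftComm X 1 n).hom, Category.assoc]
    erw [hu]
    rw [Units.smul_def, Linear.comp_smul, h0, smul_zero]

end Cones

/-! ### A nonzero element over an object with maximal radical annihilator. -/

section Elements

lemma map_apply_ne_zero {C : Type*} [Category* C] (F : C ⥤ AddCommGrpCat.{w}) {X Y : C}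
    (f : X ⟶ Y) [IsIso f] {x : F.obj X} (hx : x ≠ 0) : F.map f x ≠ 0 := fun h => hx <| by
  have := congr_arg (F.map (inv f)) h
  rwa [map_zero, ← ConcreteCategory.comp_apply, ← F.map_comp, IsIso.hom_inv_id, F.map_id,
    ConcreteCategory.id_apply] at this

variable {T : Type u} [Category.{w} T] [Preadditive T] [HasZeroObject T] [HasShift T ℤ]
  [∀ n : ℤ, (shiftFunctor T n).Additive] [Pretriangulated T]
  {R : Type w} [Ring R] {𝒜 : ℤ → AddSubgroup R} [GradedRing 𝒜] {φ : CentralAction T 𝒜}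
  (F : Tᵒᵖ ⥤ AddCommGrpCat.{w}) [F.IsHomological]

/-- If `r` annihilates a nonzero element of `F^*(Y)`, then there is a nonzero element of `F(Z)`
where `Z` is annihilated, up to radical, by `r` and the annihilator of `Y`. -/
lemma exists_radical_annihilator_le (h𝒜 : IsGradedCommutative 𝒜) {Y : T} {b a e : ℤ}
    (y : F.obj (op (Y⟦a⟧))) (hy : y ≠ 0) (r : 𝒜 e) (hab : b + e = a)
    (hr : F.map ((φ.act r b a hab).app Y).op y = 0) :
    ∃ (Z : T) (z : F.obj (op Z)), z ≠ 0 ∧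
      h𝒜.radical (φ.annihilator Y) ≤ h𝒜.radical (φ.annihilator Z) ∧
      (r : R) ∈ h𝒜.radical (φ.annihilator Z) := by
  obtain ⟨Z, g, δ, hT⟩ := distinguished_cocone_triangle ((φ.hom e r).1.app (Y⟦b⟧))
  let i : Y⟦b⟧⟦e⟧ ⟶ Y⟦a⟧ := (shiftFunctorAdd' T b e a hab).inv.app Y
  have hy' : F.map i.op y ≠ 0 := map_apply_ne_zero F _ hy
  have hex := F.map_distinguished_op_exact _ hT
  rw [ShortComplex.ab_exact_iff] at hex
  -- `F` is exact on the triangle, so an element killed by `r` comes from the cone.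
  obtain ⟨z, hz⟩ := hex (F.map i.op y) (by
    rw [φ.act_app, op_comp, F.map_comp, ConcreteCategory.comp_apply] at hr
    exact hr)
  refine ⟨Z, z, fun h => hy' (hz.symm.trans ((congr_arg (F.map g.op) h).trans (map_zero _))), ?_, ?_⟩
  · rw [homogeneousIdeal_le_iff]
    intro n s hs hsY
    rw [h𝒜.mem_radical hs] at hsY ⊢
    obtain ⟨k, hk⟩ := hsY
    have hsk := SetLike.pow_mem_graded k hs
    rw [CentralAction.mem_annihilator hsk] at hk
    have hk2 := SetLike.GradedMul.mul_mem hsk hsk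
    -- `s ^ k` kills both shifts of `Y` in the triangle, so its square kills the cone.
    refine ⟨k + k, ?_⟩
    rw [pow_add, CentralAction.mem_annihilator hk2]
    exact (hk.shift b).mul_self_of_distinguished (r := ⟨s ^ k, hsk⟩) hT
      ((hk.shift b).shift e) hk2
  · rw [h𝒜.mem_radical r.2]
    have h2 := SetLike.GradedMul.mul_mem r.2 r.2
    refine ⟨2, ?_⟩
    rw [pow_two, CentralAction.mem_annihilator h2]
    exact CentralAction.kills_mul_self_cone hT h2

/-- A nonzero homological functor `F` has an element `y ∈ F(Y⟦0⟧)` such that the radical of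
the annihilator of `Y` is prime and contains all homogeneous elements annihilating `y`. -/
lemma exists_prime_eq_radical_annihilator [IsNoetherianRing R] (h𝒜 : IsGradedCommutative 𝒜)
    (φ : CentralAction T 𝒜) (hF : ¬ IsZero F) :
    ∃ (p : HomogeneousPrime 𝒜) (Y : T) (y : F.obj (op (Y⟦(0 : ℤ)⟧))),
      p.ideal = h𝒜.radical (φ.annihilator Y) ∧ ∀ (e b : ℤ) (h : b + e = 0) (r : 𝒜 e),
        F.map ((φ.act r b 0 h).app Y).op y = 0 → (r : R) ∈ p.ideal := by
  let rad (X : T) : HomogeneousIdeal 𝒜 := h𝒜.radical (φ.annihilator X)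
  obtain ⟨Y, y, hy, hmax⟩ : ∃ (Y : T) (y : F.obj (op Y)), y ≠ 0 ∧
      ∀ (Z : T) (z : F.obj (op Z)), z ≠ 0 → rad Y ≤ rad Z → rad Z ≤ rad Y := by
    have hne : {I : Ideal R | ∃ (Y : T) (y : F.obj (op Y)), y ≠ 0 ∧
        I = (rad Y).toIdeal}.Nonempty := by
      by_contra hempty
      refine hF ((Functor.isZero_iff F).2 fun X => ?_)
      rw [AddCommGrpCat.isZero_iff_subsingleton]
      refine subsingleton_of_forall_eq 0 fun y => ?_
      by_contra hy
      exact hempty ⟨_, X.unop, y, hy, rfl⟩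
    obtain ⟨I, ⟨Y, y, hy, rfl⟩, hI⟩ := set_has_maximal_iff_noetherian.2 ‹IsNoetherianRing R› _ hne
    refine ⟨Y, y, hy, fun Z z hz hle => ?_⟩
    by_contra hlt
    exact hI _ ⟨Z, z, hz, rfl⟩ (lt_of_le_not_ge hle hlt)
  have hann : ∀ (a b e : ℤ) (y : F.obj (op (Y⟦a⟧))) (_ : y ≠ 0) (r : 𝒜 e) (hab : b + e = a),
      F.map ((φ.act r b a hab).app Y).op y = 0 → (r : R) ∈ rad Y := by
    intro a b e y hy r hab h
    obtain ⟨Z, z, hz, hle, hr⟩ := exists_radical_annihilator_le F h𝒜 y hy r hab h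
    exact hmax Z z hz hle hr
  have hy₀ : F.map ((shiftFunctorZero T ℤ).hom.app Y).op y ≠ 0 := map_apply_ne_zero F _ hy
  refine ⟨⟨rad Y, ?_, ?_⟩, Y, _, rfl, fun e b h r => hann _ _ _ _ hy₀ r h⟩
  · intro h
    obtain ⟨k, hk⟩ := (h𝒜.mem_radical SetLike.GradedOne.one_mem).1 h
    rw [one_pow, CentralAction.one_mem_annihilator_iff] at hk
    apply hy
    -- If `1` kills `Y`, then `𝟙 Y = 0`, which forces `y = 0`.
    rw [← ConcreteCategory.id_apply (C := AddCommGrpCat) y, ← F.map_id, ← op_id, hk, op_zero,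
      F.map_zero]
    rfl
  · intro m n r s hr hs hrs
    by_contra! hcon
    obtain ⟨hr', hs'⟩ := hcon
    obtain ⟨k, hk⟩ := (h𝒜.mem_radical (SetLike.GradedMul.mul_mem hr hs)).1 hrs
    obtain ⟨u, hu⟩ := h𝒜.exists_mul_pow hr hs k
    have hrk := SetLike.pow_mem_graded k hr
    have hsk := SetLike.pow_mem_graded k hs
    have hpow : r ^ k * s ^ k ∈ φ.annihilator Y := by
      have := units_smul_mem _ u⁻¹ hk
      rwa [hu, inv_smul_smul] at this
    have hrs' := SetLike.GradedMul.mul_mem hrk hsk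
    rw [CentralAction.mem_annihilator hrs'] at hpow
    have of_pow : ∀ {d : ℤ} {t : R}, t ∈ 𝒜 d → t ^ k ∈ rad Y → t ∈ rad Y := by
      intro d t ht h
      obtain ⟨l, hl⟩ := (h𝒜.mem_radical (SetLike.pow_mem_graded k ht)).1 h
      exact (h𝒜.mem_radical ht).2 ⟨k * l, by rwa [pow_mul]⟩
    have hact := hpow.act_app_eq_zero (0 - (k • n) - (k • m)) 0 (by omega)
    rw [φ.act_mul ⟨r ^ k, hrk⟩ ⟨s ^ k, hsk⟩ rfl hrs' 0 (0 - k • n) _ (by omega) (by omega)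
      (by omega)] at hact
    -- Either `s ^ k` kills `y`, or `s ^ k y` is a nonzero element killed by `r ^ k`; `hann` covers
    -- it because it allows every shift of `Y`.
    by_cases hz : F.map ((φ.act ⟨s ^ k, hsk⟩ (0 - k • n) 0 (by omega)).app Y).op
        (F.map ((shiftFunctorZero T ℤ).hom.app Y).op y) = 0
    · exact hs' (of_pow hs (hann _ _ _ _ hy₀ ⟨s ^ k, hsk⟩ _ hz))
    · refine hr' (of_pow hr (hann _ (0 - (k • n) - (k • m)) _ _ hz ⟨r ^ k, hrk⟩ (by omega) ?_))
      rw [← ConcreteCategory.comp_apply, ← F.map_comp, ← op_comp, ← NatTrans.comp_app, hact,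
        op_zero, F.map_zero]
      rfl

end Elements

/-! ### Torsion objects and the kernel of localisation. -/

section Localisation

variable {T : Type u} [Category.{w} T] [Preadditive T] [HasShift T ℤ]
  [∀ n : ℤ, (shiftFunctor T n).Additive]
  {R : Type w} [Ring R] {𝒜 : ℤ → AddSubgroup R} [GradedRing 𝒜] (φ : CentralAction T 𝒜)

/-- The value of `F_p` at `X` is a colimit of the values of the diagram of fractions. -/
noncomputable def isColimitLocalizeObj (p : HomogeneousPrime 𝒜) (F : Tᵒᵖ ⥤ AddCommGrpCat.{w})
    (X : T) : IsColimit (((evaluation _ _).obj (op X)).mapCocone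
      (colimit.cocone (fractionDiagram φ p F))) :=
  isColimitOfPreserves _ (colimit.isColimit _)

variable {φ}

lemma isZero_localize (p : HomogeneousPrime 𝒜) {F : Tᵒᵖ ⥤ AddCommGrpCat.{w}} (hF : IsZero F) :
    IsZero (localize φ p F) := by
  rw [IsZero.iff_id_eq_zero]
  refine colimit.hom_ext fun s => IsZero.eq_of_src ?_ _ _
  exact (Functor.isZero_iff _).2 fun X => (Functor.isZero_iff _).1 hF _

/-- If `q` does not contain `p`, some homogeneous `r ∈ p` lies outside `q`; a power of `r` kills `X`
and becomes a denominator at `q`. -/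
lemma mem_torsionObjects_of_pow_mem (p : HomogeneousPrime 𝒜) {X : T}
    (hX : ∀ (n : ℤ), ∀ r ∈ 𝒜 n, r ∈ p.ideal → ∃ k : ℕ, r ^ k ∈ φ.annihilator X) :
    torsionObjects φ (zeroLocus p.ideal) X := by
  intro q hq n
  have hle : ¬ p.ideal ≤ q.ideal := hq
  rw [homogeneousIdeal_le_iff] at hle
  push Not at hle
  obtain ⟨d, r, hr, hrp, hrq⟩ := hle
  obtain ⟨k, hk⟩ := hX d r hr hrp
  have hrk := SetLike.pow_mem_graded k hr
  rw [IsZero.iff_id_eq_zero]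
  refine (isColimitLocalizeObj φ q _ _).hom_ext fun s => ?_
  -- Enlarging the denominator by `r ^ k` makes the transition map zero, so every leg of the colimit
  -- vanishes.
  let t : Denominator q := ⟨k • d + s.deg, r ^ k * s.val, SetLike.GradedMul.mul_mem hrk s.mem,
    q.mul_notMem hrk s.mem (q.pow_notMem hr hrq k) s.notMem⟩
  let f : s ⟶ t := ⟨r ^ k, by simpa [t] using hrk, rfl⟩
  have hf : ((fractionDiagram φ q (preadditiveYoneda.obj X)).map f).app (op (X⟦-n⟧)) = 0 := by
    have h0 := (((CentralAction.mem_annihilator f.2.1).1 hk).shift (-n)).act_app_eq_zero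
      (-t.deg) (-s.deg) (by omega)
    change (preadditiveYoneda.obj X).map (Quiver.Hom.op (NatTrans.app _ _)) = 0
    rw [h0, op_zero, Functor.map_zero]
  have := congr_app (colimit.w (fractionDiagram φ q (preadditiveYoneda.obj X)) f) (op (X⟦-n⟧))
  rw [NatTrans.comp_app, hf, zero_comp] at this
  change (colimit.ι (fractionDiagram φ q (preadditiveYoneda.obj X)) s).app _ ≫ _ =
    (colimit.ι (fractionDiagram φ q (preadditiveYoneda.obj X)) s).app _ ≫ _
  rw [← this]
  exact zero_comp.trans zero_comp.symm

/-- The canonical morphism `F ⟶ F_p`. -/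
noncomputable def toLocalize (φ : CentralAction T 𝒜) (p : HomogeneousPrime 𝒜)
    (F : Tᵒᵖ ⥤ AddCommGrpCat.{w}) :
    F ⟶ localize φ p F :=
  Functor.whiskerRight (NatTrans.op (shiftFunctorZero T ℤ).hom) F ≫
    colimit.ι (fractionDiagram φ p F) (.one p)

/-- The kernel of `F ⟶ F_p` consists of the elements annihilated by an element outside `p`. -/
lemma exists_act_eq_zero_of_toLocalize (h𝒜 : IsGradedCommutative 𝒜) (p : HomogeneousPrime 𝒜)
    (F : Tᵒᵖ ⥤ AddCommGrpCat.{w}) {Y : T} (y : F.obj (op (Y⟦(0 : ℤ)⟧)))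
    (hy : (colimit.ι (fractionDiagram φ p F) (.one p)).app (op Y) y = 0) :
    ∃ (e b : ℤ) (h : b + e = 0) (r : 𝒜 e), (r : R) ∉ p.ideal ∧
      F.map ((φ.act r b 0 h).app Y).op y = 0 := by
  have := h𝒜.isFiltered_denominator p
  obtain ⟨t, f, g, hfg⟩ := Concrete.isColimit_exists_of_rep_eq
    (fractionDiagram φ p F ⋙ (evaluation _ _).obj (op Y)) (isColimitLocalizeObj φ p F Y)
    (i := .one p) (j := .one p) y 0 (by rw [map_zero]; exact hy)
  -- A morphism out of the denominator `1` is multiplication by its target.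
  have hf : f.1 = t.val := (mul_one f.1).symm.trans f.2.2
  refine ⟨t.deg - (Denominator.one p).deg, -t.deg, by simp [Denominator.one], ⟨f.1, f.2.1⟩, by
    rw [hf]; exact t.notMem, ?_⟩
  rw [map_zero] at hfg
  exact hfg

end Localisation

/-! ### Vanishing and nonvanishing of the colimit defining `Γ`. -/

section Extension

/-- The colimit cocone that defines `pullback f F`. -/
noncomputable def pullbackCocone {C : Type u} {D : Type u} [Category.{w} C] [Preadditive C]
    [EssentiallySmall.{w} C] [Category.{w} D] [Preadditive D]
    (f : C ⥤ D) (F : Cᵒᵖ ⥤ AddCommGrpCat.{w}) :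
    Cocone (CostructuredArrow.proj preadditiveYoneda F ⋙ f ⋙ preadditiveYoneda) :=
  haveI : HasColimitsOfShape (CostructuredArrow (preadditiveYoneda (C := C)) F)
      AddCommGrpCat.{w} := hasColimitsOfShape_of_equivalence (equivSmallModel.{w} _).symm
  colimit.cocone _

lemma pullbackCocone_pt {C : Type u} {D : Type u} [Category.{w} C] [Preadditive C]
    [EssentiallySmall.{w} C] [Category.{w} D] [Preadditive D]
    (f : C ⥤ D) (F : Cᵒᵖ ⥤ AddCommGrpCat.{w}) : (pullbackCocone f F).pt = pullback f F := rfl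

/-- `pullbackCocone` is a colimit cocone. -/
noncomputable def isColimitPullbackCocone {C : Type u} {D : Type u} [Category.{w} C]
    [Preadditive C] [EssentiallySmall.{w} C] [Category.{w} D] [Preadditive D]
    (f : C ⥤ D) (F : Cᵒᵖ ⥤ AddCommGrpCat.{w}) : IsColimit (pullbackCocone f F) :=
  haveI : HasColimitsOfShape (CostructuredArrow (preadditiveYoneda (C := C)) F)
      AddCommGrpCat.{w} := hasColimitsOfShape_of_equivalence (equivSmallModel.{w} _).symm
  colimit.isColimit _

/-- The functor `pullback f` maps zero to zero if `f` hits a zero object. -/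
lemma isZero_pullback {C : Type u} {D : Type u} [Category.{w} C] [Preadditive C]
    [EssentiallySmall.{w} C] [Category.{w} D] [Preadditive D]
    (f : C ⥤ D) {F : Cᵒᵖ ⥤ AddCommGrpCat.{w}} (hF : IsZero F) {O : C} (hO : IsZero (f.obj O)) :
    IsZero (pullback f F) := by
  rw [← pullbackCocone_pt, IsZero.iff_id_eq_zero]
  refine (isColimitPullbackCocone f F).hom_ext fun A => ?_
  -- As `F = 0`, every pair maps to `(O, 0)`, so every leg factors through `H_{f(O)} = 0`.
  let B : CostructuredArrow (preadditiveYoneda (C := C)) F := CostructuredArrow.mk (Y := O) 0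
  let g : A ⟶ B := CostructuredArrow.homMk 0 (hF.eq_of_tgt _ _)
  have hB : IsZero (preadditiveYoneda.obj (f.obj O)) :=
    (Functor.isZero_iff _).2 fun X => by
      rw [AddCommGrpCat.isZero_iff_subsingleton]
      exact ⟨fun a b => hO.eq_of_tgt a b⟩
  rw [← (pullbackCocone f F).w g, Category.assoc, Category.assoc]
  congr 1
  exact hB.eq_of_src _ _

/-- A morphism `H_Z ⟶ G` with `Z` in `S` that is nonzero at `Z` factors through `Γ G` there. -/
lemma not_isZero_colocalize {T : Type u} [Category.{w} T] [Preadditive T] [EssentiallySmall.{w} T]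
    (S : ObjectProperty T) (G : Tᵒᵖ ⥤ AddCommGrpCat.{w}) {Z : T} (hZ : S Z)
    (α : preadditiveYoneda.obj Z ⟶ G) (hα : α.app (op Z) (𝟙 Z) ≠ 0) :
    ¬ IsZero (colocalize S G) := by
  intro h
  let Z' : S.FullSubcategory := ⟨Z, hZ⟩
  let K := CostructuredArrow.proj preadditiveYoneda (pushforward S.ι G) ⋙ S.ι ⋙ preadditiveYoneda
  -- The counit `Γ G ⟶ G` evaluated at `Z`, written as a cocone.
  let c : Cocone (K ⋙ (evaluation _ _).obj (op Z)) :=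
    { pt := G.obj (op Z)
      ι :=
        { app := fun A => AddCommGrpCat.ofHom (AddMonoidHom.mk'
            (fun g : Z ⟶ A.left.obj => (A.hom.app (op Z') (ObjectProperty.homMk g) : G.obj (op Z)))
            fun a b => map_add (A.hom.app (op Z')).hom (ObjectProperty.homMk a : Z' ⟶ A.left)
              (ObjectProperty.homMk b))
          naturality := fun A B g => by
            ext x
            exact ConcreteCategory.congr_hom (NatTrans.congr_app (CostructuredArrow.w g) (op Z'))
              (ObjectProperty.homMk x : Z' ⟶ A.left) } }
  let hc := isColimitOfPreserves ((evaluation _ _).obj (op Z))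
    (isColimitPullbackCocone S.ι (pushforward S.ι G))
  -- The leg at this pair sends `𝟙 Z` to the value of `α`, so it cannot factor through a zero group.
  let A : CostructuredArrow preadditiveYoneda (pushforward S.ι G) :=
    CostructuredArrow.mk (Y := Z') (preadditiveYonedaMap S.ι Z' ≫ Functor.whiskerLeft S.ι.op α)
  have hpt : IsZero ((pullbackCocone S.ι (pushforward S.ι G)).pt.obj (op Z)) :=
    (Functor.isZero_iff _).1 h _
  have h0 : c.ι.app A = 0 := by
    rw [← hc.fac c A, show hc.desc c = 0 from hpt.eq_of_src _ _, comp_zero]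
  exact hα (ConcreteCategory.congr_hom h0 (𝟙 Z))

end Extension

/-! ### Detecting membership in the support. -/

section Support

variable {T : Type u} [Category.{w} T] [Preadditive T] [HasShift T ℤ]
  [∀ n : ℤ, (shiftFunctor T n).Additive] [EssentiallySmall.{w} T]
  {R : Type w} [Ring R] {𝒜 : ℤ → AddSubgroup R} [GradedRing 𝒜] {φ : CentralAction T 𝒜}

lemma isZero_gammaPrime [HasZeroObject T] (p : HomogeneousPrime 𝒜) {F : Tᵒᵖ ⥤ AddCommGrpCat.{w}}
    (hF : IsZero F) : IsZero (gammaPrime φ p F) := by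
  obtain ⟨O, hO⟩ := HasZeroObject.zero (C := T)
  have hOt : torsionObjects φ (zeroLocus p.ideal) O := fun q _ n =>
    (Functor.isZero_iff _).1 (isZero_localize q ((Functor.isZero_iff _).2 fun X => by
      rw [AddCommGrpCat.isZero_iff_subsingleton]
      exact ⟨fun a b => hO.eq_of_tgt a b⟩)) _
  exact isZero_pullback _
    ((Functor.isZero_iff _).2 fun X => (Functor.isZero_iff _).1 (isZero_localize p hF) _)
    (O := ⟨O, hOt⟩) hO

lemma mem_supp_of_toLocalize_ne_zero (p : HomogeneousPrime 𝒜) (F : Tᵒᵖ ⥤ AddCommGrpCat.{w})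
    [F.Additive] {Z : T} (hZ : torsionObjects φ (zeroLocus p.ideal) Z) (y : F.obj (op Z))
    (hy : (toLocalize φ p F).app (op Z) y ≠ 0) : p ∈ supp φ F := by
  -- The Yoneda morphism of `y`; additivity of `F` makes its components group homomorphisms.
  let α : preadditiveYoneda.obj Z ⟶ F :=
    { app := fun W => AddCommGrpCat.ofHom (AddMonoidHom.mk'
        (fun g : W.unop ⟶ Z => (F.map g.op y : F.obj W)) fun a b =>
          ConcreteCategory.congr_hom (F.map_add (f := Quiver.Hom.op a) (g := Quiver.Hom.op b)) y)
      naturality := fun W V g => by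
        ext x
        exact ConcreteCategory.congr_hom (F.map_comp (Quiver.Hom.op x) g) y }
  refine not_isZero_colocalize _ _ hZ (α ≫ toLocalize φ p F) ?_
  have h1 : α.app (op Z) (𝟙 Z) = y := by
    change F.map (𝟙 Z).op y = y
    rw [op_id, F.map_id]
    rfl
  change (toLocalize φ p F).app (op Z) (α.app (op Z) (𝟙 Z)) ≠ 0
  rwa [h1]

end Support

end CohSupport

theorem proposition4p1 {T : Type u} [Category.{w} T] [Preadditive T] [HasZeroObject T]
    [HasShift T ℤ] [∀ n : ℤ, (shiftFunctor T n).Additive] [Pretriangulated T] [IsTriangulated T]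
    [EssentiallySmall.{w} T]
    {R : Type w} [Ring R] [IsNoetherianRing R] (𝒜 : ℤ → AddSubgroup R) [GradedRing 𝒜]
    (h𝒜 : CohSupport.IsGradedCommutative 𝒜) (φ : CohSupport.CentralAction T 𝒜)
    (F : Tᵒᵖ ⥤ AddCommGrpCat.{w}) [F.IsHomological] :
    CohSupport.supp φ F = ∅ ↔ IsZero F := by
  constructor
  · intro h
    by_contra hF
    obtain ⟨p, Y, y, hp, hann⟩ := CohSupport.exists_prime_eq_radical_annihilator F h𝒜 φ hF
    have hY : CohSupport.torsionObjects φ (CohSupport.zeroLocus p.ideal) Y :=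
      CohSupport.mem_torsionObjects_of_pow_mem p fun n r hr hrp =>
        (h𝒜.mem_radical hr).1 (hp ▸ hrp)
    refine Set.eq_empty_iff_forall_notMem.1 h p (CohSupport.mem_supp_of_toLocalize_ne_zero p F hY
      (F.map ((shiftFunctorZero T ℤ).inv.app Y).op y) fun h0 => ?_)
    -- `y` lives over `Y⟦0⟧`, while `toLocalize` starts at `Y`; the two identifications cancel.
    have h1 : F.map ((shiftFunctorZero T ℤ).hom.app Y).op
        (F.map ((shiftFunctorZero T ℤ).inv.app Y).op y) = y := by
      rw [← ConcreteCategory.comp_apply, ← F.map_comp, ← op_comp, Iso.hom_inv_id_app, op_id,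
        F.map_id, ConcreteCategory.id_apply]
    have h2 : (colimit.ι (CohSupport.fractionDiagram φ p F) (.one p)).app (op Y) y = 0 := by
      rw [← h1]
      exact h0
    obtain ⟨e, b, hb, r, hr, hry⟩ := CohSupport.exists_act_eq_zero_of_toLocalize h𝒜 p F y h2
    exact hr (hann e b hb r hry)
  · intro hF
    exact Set.eq_empty_iff_forall_notMem.2 fun p hp => hp (CohSupport.isZero_gammaPrime p hF)
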